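/- All graphs are finite and simple. A \emph{path-decomposition} of a graph $G$ is a sequence $B_0,\dots,B_n$ ($n\ge 0$) of subsets of $V(G)$ such that for every $v\in V(G)$ the set $\{i : v\in B_i\}$ is a non-empty interval of $\{0,\dots,n\}$, and for every edge $uv\in E(G)$ some $B_i$ contains both $u$ and $v$. Its \emph{width} is $\max_i (|B_i|-1)$, and the \emph{pathwidth} $\mathrm{pw}(G)$ is the minimum width of a path-decomposition of $G$. A \emph{subdivision} of a graph $F$ is a graph obtained from $F$ by replacing the edges of $F$ by internally disjoint paths (of length at least one) between their ends. For $h\ge 0$, the complete binary tree with $2^{h+1}-1$ vertices is the rooted tree in which every vertex at distance less than $h$ from the root has exactly two children, and the vertices at distance $h$ are leaves. For every integer $k\ge 1$, every graph $G$ with $\mathrm{pw}(G)\ge 2^{2k+1}-2$ contains a bipartite subgraph $\hat G\subseteq G$ with $\mathrm{pw}(\hat G)\ge k$; moreover, $\hat G$ can be chosen to be a subdivision of a complete binary tree. -/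

import Mathlib

namespace SimpleGraph

universe u v

/-- A path-decomposition of `G`: a tree-decomposition whose tree is the path on the nodes
`0, 1, ..., n` (a tree is non-empty, so the path has at least one node). `bags t` is the bag of
the node `t`. -/
structure PathDecomposition {V : Type u} (G : SimpleGraph V) where
  n : ℕ
  bags : Fin (n + 1) → Finset V
  /-- The nodes whose bags contain `x` induce a non-empty connected subgraph of the path
  (`Connected` includes non-emptiness). -/
  connected : ∀ x : V, ((pathGraph (n + 1)).induce {t | x ∈ bags t}).Connected
  /-- Both ends of every edge lie in a common bag. -/
  edge : ∀ x y : V, G.Adj x y → ∃ t, x ∈ bags t ∧ y ∈ bags t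

/-- The width of a path-decomposition: the maximum of `|B| - 1` over all bags `B`. (The truncated
subtraction only matters if all bags are empty, that is, if the graph has no vertex.) -/
def PathDecomposition.width {V : Type u} {G : SimpleGraph V} (D : G.PathDecomposition) : ℕ :=
  Finset.univ.sup fun t => (D.bags t).card - 1

/-- The pathwidth of a (finite) graph: the minimum width of a path-decomposition. The graph
without vertices gets the value `0`. -/
noncomputable def pathwidth {V : Type u} (G : SimpleGraph V) : ℕ :=
  sInf (Set.range (PathDecomposition.width (G := G)))

/-- A finite graph has a path-decomposition, namely one with a single bag. -/
theorem nonempty_pathDecomposition {V : Type u} [Finite V] (G : SimpleGraph V) :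
    Nonempty G.PathDecomposition := by
  have := Fintype.ofFinite V
  refine ⟨⟨0, fun _ => Finset.univ, fun x => ?_, fun x y _ => ⟨0, by simp⟩⟩⟩
  have : Nonempty {t : Fin (0 + 1) | x ∈ (Finset.univ : Finset V)} := ⟨⟨0, by simp⟩⟩
  refine ⟨fun a b => ?_⟩
  rw [show a = b from Subtype.ext (Subsingleton.elim (α := Fin 1) _ _)]

/-- The minimum in the definition of the pathwidth of a finite graph is attained. -/
theorem exists_width_eq_pathwidth {V : Type u} [Finite V] (G : SimpleGraph V) :
    ∃ D : G.PathDecomposition, D.width = G.pathwidth := by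
  have := G.nonempty_pathDecomposition
  exact Nat.sInf_mem (Set.range_nonempty (PathDecomposition.width (G := G)))

/-- The complete binary tree in which every path from the root to a leaf has `h` edges (so it has
`2 ^ (h + 1) - 1` vertices). The vertices are the words of length at most `h` over two letters; the
root is the empty word and the children of a word `l` of length less than `h` are `false :: l`
and `true :: l`. -/
def completeBinaryTree (h : ℕ) : SimpleGraph {l : List Bool // l.length ≤ h} where
  Adj l m := ∃ b : Bool, m.1 = b :: l.1 ∨ l.1 = b :: m.1
  symm := ⟨fun _ _ ⟨b, hb⟩ => ⟨b, hb.symm⟩⟩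
  loopless := ⟨fun l ⟨b, hb⟩ => by simp at hb⟩

/-- A witness that `H` is a subdivision of `F`: `H` arises from `F` by replacing the edges of `F`
by internally disjoint paths between their ends. -/
structure Subdivision {V : Type u} {W : Type v} (F : SimpleGraph W) (H : SimpleGraph V) where
  /-- The vertex of `H` that represents a given vertex of `F`. -/
  branch : W ↪ V
  /-- The path of `H` that replaces the edge `ab` of `F`, directed from `a` to `b`. -/
  path : ∀ ⦃a b : W⦄, F.Adj a b → H.Walk (branch a) (branch b)
  isPath : ∀ ⦃a b : W⦄ (h : F.Adj a b), (path h).IsPath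
  /-- The two directions of an edge of `F` give the same path of `H`. -/
  path_symm : ∀ ⦃a b : W⦄ (h : F.Adj a b), path h.symm = (path h).reverse
  /-- A path contains no branch vertices other than its ends. -/
  branch_mem : ∀ ⦃a b c : W⦄ (h : F.Adj a b), branch c ∈ (path h).support → c = a ∨ c = b
  /-- Paths that replace different edges share no vertices but branch vertices. -/
  disjoint : ∀ ⦃a b c d : W⦄ (h : F.Adj a b) (h' : F.Adj c d), s(a, b) ≠ s(c, d) →
    ∀ x : V, x ∈ (path h).support → x ∈ (path h').support → x ∈ Set.range branch
  /-- `H` has no further vertices. -/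
  vert : ∀ x : V, x ∈ Set.range branch ∨ ∃ (a b : W) (h : F.Adj a b), x ∈ (path h).support
  /-- `H` has no further edges. -/
  edge : ∀ x y : V, H.Adj x y → ∃ (a b : W) (h : F.Adj a b), s(x, y) ∈ (path h).edges

/-- `H` is a subdivision of `F`. -/
def IsSubdivisionOf {V : Type u} {W : Type v} (H : SimpleGraph V) (F : SimpleGraph W) : Prop :=
  Nonempty (Subdivision F H)

end SimpleGraph

/-! Write ∂X for the set of vertices of X with a neighbour outside X. If V(G) can be built vertex by
vertex so that every set before the last has at most w boundary vertices, then the bags formed by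
each boundary together with the next vertex give a path-decomposition of width at most w. So if the
pathwidth is w + 1, every such construction gets stuck. Call a buildable set saturated if no larger
buildable set has at most as many boundary vertices. Adding a vertex v to a saturated X raises |∂X|
by exactly one, and the result extends to a saturated Y with |∂Y| = |∂X| + 1. By submodularity of
|∂|, a smallest-boundary set between X + v and Y is again buildable, so by saturation of X no
bottleneck exists, and Menger's theorem links ∂X + v to ∂Y by disjoint paths
(`Saturated.exists_isLinkage`). Hence a binary tree can be grown from a boundary vertex: each tree
vertex costs one boundary vertex, while the unfinished ends are carried along by the linkages
(`Saturated.exists_hangingTree`). Pathwidth at least 2^(h+1) thus yields a subdivided complete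
binary tree of height h. Such a subdivision is bipartite by parity of depth. Its pathwidth is
bounded below by induction: descending two levels gives three disjoint subtrees, each with a large
set in some bag, and the middle one of these bags also meets the connection between the other two
(`exists_card_le_bag`). Two levels gain one vertex, so height 2k - 1 suffices for pathwidth k. -/

namespace SimpleGraph

/-- The vertices of `X` that have a neighbour outside `X`. -/
noncomputable def innerBoundary {V : Type*} (G : SimpleGraph V) (X : Finset V) : Finset V :=
  open scoped Classical in X.filter fun x => ∃ y, y ∉ X ∧ G.Adj x y

/-! ### Inner boundaries and buildable sets -/

section Boundary

variable {V : Type*} {G : SimpleGraph V} {X Y : Finset V}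

theorem mem_innerBoundary {x : V} :
    x ∈ G.innerBoundary X ↔ x ∈ X ∧ ∃ y, y ∉ X ∧ G.Adj x y := by
  classical
  simp [innerBoundary]

theorem innerBoundary_subset (G : SimpleGraph V) (X : Finset V) : G.innerBoundary X ⊆ X :=
  fun _ h => (mem_innerBoundary.1 h).1

theorem innerBoundary_empty (G : SimpleGraph V) : G.innerBoundary ∅ = ∅ :=
  Finset.subset_empty.1 (G.innerBoundary_subset ∅)

theorem innerBoundary_insert_subset [DecidableEq V] (v : V) :
    G.innerBoundary (insert v X) ⊆ insert v (G.innerBoundary X) := by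
  intro x hx
  obtain ⟨hx, y, hy, hxy⟩ := mem_innerBoundary.1 hx
  rw [Finset.mem_insert] at hx ⊢
  rw [Finset.mem_insert, not_or] at hy
  exact hx.imp_right fun h => mem_innerBoundary.2 ⟨h, y, hy.2, hxy⟩

/-- The size of the inner boundary is a submodular set function. -/
theorem card_innerBoundary_inter_add_union_le [DecidableEq V] (G : SimpleGraph V)
    (X Y : Finset V) :
    (G.innerBoundary (X ∩ Y)).card + (G.innerBoundary (X ∪ Y)).card ≤
      (G.innerBoundary X).card + (G.innerBoundary Y).card := by
  rw [← Finset.card_union_add_card_inter, ← Finset.card_union_add_card_inter (G.innerBoundary X)]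
  apply Nat.add_le_add <;> apply Finset.card_le_card <;> intro x <;>
    simp only [Finset.mem_union, Finset.mem_inter, mem_innerBoundary] <;> grind

/-- The sets `X` that can be built by adding one vertex at a time, such that all the sets before
`X` have at most `w` boundary vertices. -/
inductive Buildable [DecidableEq V] (G : SimpleGraph V) (w : ℕ) : Finset V → Prop
  | empty : Buildable G w ∅
  | insert_vertex (v : V) {X : Finset V} : Buildable G w X → (G.innerBoundary X).card ≤ w →
      Buildable G w (insert v X)

/-- Intersect every stage P of a construction of Y with Z. As |∂(P ∪ Z)| ≥ |∂Z|, submodularity gives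
|∂(P ∩ Z)| ≤ |∂P| ≤ w. -/
theorem Buildable.of_subset [DecidableEq V] {w : ℕ} {Z : Finset V} (hY : G.Buildable w Y)
    (hZY : Z ⊆ Y)
    (hZ : ∀ Z', Z ⊆ Z' → Z' ⊆ Y → (G.innerBoundary Z).card ≤ (G.innerBoundary Z').card) :
    G.Buildable w Z := by
  suffices h : ∀ P, G.Buildable w P → P ⊆ Y → G.Buildable w (P ∩ Z) by
    simpa [Finset.inter_eq_right.2 hZY] using h Y hY subset_rfl
  intro P hP
  induction hP with
  | empty => intro _; simpa using Buildable.empty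
  | @insert_vertex v P _ hw ih =>
    intro hPY
    have hPY' := (Finset.subset_insert v P).trans hPY
    by_cases hv : v ∈ Z
    · rw [Finset.insert_inter_of_mem hv]
      refine (ih hPY').insert_vertex v ?_
      have := hZ (P ∪ Z) Finset.subset_union_right (Finset.union_subset hPY' hZY)
      have := G.card_innerBoundary_inter_add_union_le P Z
      omega
    · rw [Finset.insert_inter_of_notMem hv]
      exact ih hPY'

end Boundary

/-! ### Path-decompositions from constructions -/

section Pathwidth

variable {V : Type*} {G : SimpleGraph V}

theorem connected_induce_pathGraph {n : ℕ} {s : Set (Fin n)} (hne : s.Nonempty)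
    (hs : ∀ i j k, i ≤ j → j ≤ k → i ∈ s → k ∈ s → j ∈ s) :
    ((pathGraph n).induce s).Connected := by
  have key : ∀ (d : ℕ) (i k : s), (k : Fin n).val = (i : Fin n).val + d →
      ((pathGraph n).induce s).Reachable i k := by
    intro d
    induction d with
    | zero =>
      intro i k h
      rw [show i = k from Subtype.ext (Fin.ext (by omega))]
    | succ d ih =>
      intro i k h
      have hlt : (i : Fin n).val + d < n := by omega
      let j : s := ⟨⟨(i : Fin n).val + d, hlt⟩, hs i _ k
        (by rw [Fin.le_def]; simp) (by rw [Fin.le_def]; simp [h]) i.2 k.2⟩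
      refine (ih i j rfl).trans (Adj.reachable ?_)
      rw [comap_adj, pathGraph_adj]
      left
      simp [j, h]
      omega
  have : Nonempty s := hne.to_subtype
  refine ⟨fun i k => ?_⟩
  rcases le_total (i : Fin n).val (k : Fin n).val with h | h
  · exact key _ i k (Nat.add_sub_of_le h).symm
  · exact (key _ k i (Nat.add_sub_of_le h).symm).symm

/-- A walk among the nodes whose bags contain x changes the index by one at each step, so it cannot
jump over j. -/
theorem PathDecomposition.mem_bags_of_le (D : G.PathDecomposition) {x : V}
    {i j k : Fin (D.n + 1)} (hij : i ≤ j) (hjk : j ≤ k) (hi : x ∈ D.bags i)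
    (hk : x ∈ D.bags k) : x ∈ D.bags j := by
  by_contra hj
  obtain ⟨p⟩ := (D.connected x).preconnected ⟨i, hi⟩ ⟨k, hk⟩
  have key : ∀ (a b : {t | x ∈ D.bags t})
      (p : ((pathGraph (D.n + 1)).induce {t | x ∈ D.bags t}).Walk a b),
      a.1 ≤ j → b.1 ≤ j := by
    intro a b p
    induction p with
    | nil => exact id
    | @cons a c b h p ih =>
      intro ha
      refine ih ?_
      rw [comap_adj, pathGraph_adj] at h
      have hne : a.1 ≠ j := fun e => hj (e ▸ a.2)
      have : a.1.val ≠ j.val := fun e => hne (Fin.ext e)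
      rw [Fin.le_def] at ha ⊢
      simp only [Function.Embedding.subtype_apply] at h
      omega
  have := key _ _ p hij
  exact hj ((le_antisymm hjk this) ▸ hk)

theorem pathwidth_le_of_bags {w n : ℕ} {B : ℕ → Finset V} (hcard : ∀ i < n, (B i).card ≤ w + 1)
    (hvert : ∀ x, ∃ i < n, x ∈ B i)
    (hint : ∀ x i j k, i ≤ j → j ≤ k → k < n → x ∈ B i → x ∈ B k → x ∈ B j)
    (hedge : ∀ x y, G.Adj x y → ∃ i < n, x ∈ B i ∧ y ∈ B i) : G.pathwidth ≤ w := by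
  let D : G.PathDecomposition :=
    { n := n
      -- The additional empty bag at index n makes the definition valid for n = 0; it does not
      -- affect the width.
      bags := fun t => if t.val < n then B t else ∅
      connected := fun x => by
        apply connected_induce_pathGraph
        · obtain ⟨i, hi, hx⟩ := hvert x
          exact ⟨⟨i, by omega⟩, by simp [hi, hx]⟩
        · intro i j k hij hjk hi hk
          rw [Fin.le_def] at hij hjk
          simp only [Set.mem_ofPred_eq] at hi hk ⊢
          split_ifs at hi hk ⊢ <;> first | omega | simp_all
          exact hint x i j k hij hjk (by assumption) hi hk
      edge := fun x y h => by
        obtain ⟨i, hi, hx⟩ := hedge x y h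
        exact ⟨⟨i, by omega⟩, by simp [hi, hx]⟩ }
  refine (Nat.sInf_le (Set.mem_range_self D)).trans (Finset.sup_le fun t _ => ?_)
  by_cases ht : t.val < n
  · have := hcard t ht
    simp only [D, ht, if_true]
    omega
  · simp [D, ht]

theorem Buildable.pathwidth_le [Fintype V] [DecidableEq V] {w : ℕ}
    (h : G.Buildable w Finset.univ) : G.pathwidth ≤ w := by
  suffices H : ∀ P, G.Buildable w P → ∃ (n : ℕ) (B : ℕ → Finset V),
      (∀ i < n, (B i).card ≤ w + 1) ∧ (∀ i < n, B i ⊆ P) ∧ (∀ x ∈ P, ∃ i < n, x ∈ B i) ∧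
      (∀ x i j k, i ≤ j → j ≤ k → k < n → x ∈ B i → x ∈ B k → x ∈ B j) ∧
      (∀ x ∈ P, ∀ y ∈ P, G.Adj x y → ∃ i < n, x ∈ B i ∧ y ∈ B i) ∧
      -- The last bag contains the whole boundary, so appending the bag of v and ∂P keeps the bags
      -- of each vertex consecutive.
      (∀ x ∈ G.innerBoundary P, ∀ i, i + 1 = n → x ∈ B i) by
    obtain ⟨n, B, h1, -, h3, h4, h5, -⟩ := H _ h
    exact pathwidth_le_of_bags h1 (fun x => h3 x (Finset.mem_univ x)) h4
      fun x y => h5 x (Finset.mem_univ x) y (Finset.mem_univ y)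
  intro P hP
  induction hP with
  | empty => exact ⟨0, fun _ => ∅, by simp⟩
  | @insert_vertex v P _ hw ih =>
    by_cases hv : v ∈ P
    · rwa [Finset.insert_eq_self.2 hv]
    obtain ⟨n, B, hcard, hsub, hvert, hint, hedge, hlast⟩ := ih
    have hlt : ∀ i < n, ∀ C, Function.update B n C i = B i :=
      fun i hi C => Function.update_of_ne hi.ne C B
    refine ⟨n + 1, Function.update B n (insert v (G.innerBoundary P)), ?_, ?_, ?_, ?_, ?_, ?_⟩
    · intro i hi
      rcases Nat.lt_succ_iff_lt_or_eq.1 hi with hi | rfl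
      · rw [hlt i hi]; exact hcard i hi
      · rw [Function.update_self]
        exact (Finset.card_insert_le _ _).trans (by omega)
    · intro i hi
      rcases Nat.lt_succ_iff_lt_or_eq.1 hi with hi | rfl
      · rw [hlt i hi]; exact (hsub i hi).trans (Finset.subset_insert _ _)
      · rw [Function.update_self]
        exact Finset.insert_subset_insert _ (G.innerBoundary_subset P)
    · intro x hx
      rcases Finset.mem_insert.1 hx with rfl | hx
      · exact ⟨n, by omega, by simp⟩
      · obtain ⟨i, hi, h⟩ := hvert x hx
        exact ⟨i, by omega, by rwa [hlt i hi]⟩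
    · intro x i j k hij hjk hk hxi hxk
      rcases Nat.lt_succ_iff_lt_or_eq.1 hk with hk | rfl
      · rw [hlt _ (by omega)] at hxi hxk ⊢
        exact hint x i j k hij hjk hk hxi hxk
      · rcases Nat.lt_or_eq_of_le hjk with hj | rfl
        · rw [hlt _ (by omega)] at hxi ⊢
          rw [Function.update_self] at hxk
          have hxP := hsub i (by omega) hxi
          have hxb := Finset.mem_of_mem_insert_of_ne hxk (fun e => hv (e ▸ hxP))
          exact hint x i j (k - 1) hij (by omega) (by omega) hxi
            (hlast x hxb (k - 1) (by omega))
        · exact hxk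
    · have hnew : ∀ y ∈ P, G.Adj v y → y ∈ insert v (G.innerBoundary P) := fun y hy hvy =>
        Finset.mem_insert_of_mem (mem_innerBoundary.2 ⟨hy, v, hv, hvy.symm⟩)
      intro x hx y hy hxy
      rcases Finset.mem_insert.1 hx with rfl | hx' <;>
        rcases Finset.mem_insert.1 hy with rfl | hy'
      · exact (G.irrefl hxy).elim
      · exact ⟨n, by omega, by simp, by simpa using hnew y hy' hxy⟩
      · exact ⟨n, by omega, by simpa using hnew x hx' hxy.symm, by simp⟩
      · obtain ⟨i, hi, h⟩ := hedge x hx' y hy' hxy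
        exact ⟨i, by omega, by rwa [hlt i hi]⟩
    · intro x hx i hi
      obtain rfl : i = n := by omega
      rw [Function.update_self]
      exact innerBoundary_insert_subset v hx

end Pathwidth

/-! ### Connection inside a set -/

section ConnIn

variable {V : Type*} {G : SimpleGraph V} {C D : Set V} {x y z : V}

/-- Some walk from `x` to `y` has all its vertices in `C`. -/
def ConnIn (G : SimpleGraph V) (C : Set V) (x y : V) : Prop :=
  ∃ p : G.Walk x y, ∀ z ∈ p.support, z ∈ C

theorem ConnIn.refl (h : x ∈ C) : G.ConnIn C x x :=
  ⟨Walk.nil, by simpa using h⟩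

theorem ConnIn.left_mem (h : G.ConnIn C x y) : x ∈ C :=
  let ⟨p, hp⟩ := h; hp x p.start_mem_support

theorem ConnIn.right_mem (h : G.ConnIn C x y) : y ∈ C :=
  let ⟨p, hp⟩ := h; hp y p.end_mem_support

theorem ConnIn.mono (h : G.ConnIn C x y) (hCD : C ⊆ D) : G.ConnIn D x y :=
  let ⟨p, hp⟩ := h; ⟨p, fun z hz => hCD (hp z hz)⟩

theorem ConnIn.symm (h : G.ConnIn C x y) : G.ConnIn C y x :=
  let ⟨p, hp⟩ := h; ⟨p.reverse, fun z hz => hp z (by simpa using hz)⟩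

theorem ConnIn.trans (h : G.ConnIn C x y) (h' : G.ConnIn C y z) : G.ConnIn C x z := by
  obtain ⟨p, hp⟩ := h
  obtain ⟨q, hq⟩ := h'
  refine ⟨p.append q, fun w hw => ?_⟩
  rcases Walk.mem_support_append_iff _ _ |>.1 hw with hw | hw
  exacts [hp w hw, hq w hw]

theorem ConnIn.cons (hxy : G.Adj x y) (hx : x ∈ C) (h : G.ConnIn C y z) : G.ConnIn C x z := by
  obtain ⟨p, hp⟩ := h
  refine ⟨Walk.cons hxy p, fun w hw => ?_⟩
  rcases List.mem_cons.1 (Walk.support_cons hxy p ▸ hw) with rfl | hw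
  exacts [hx, hp w hw]

theorem ConnIn.exists_isPath (h : G.ConnIn C x y) :
    ∃ p : G.Walk x y, p.IsPath ∧ ∀ z ∈ p.support, z ∈ C := by
  classical
  obtain ⟨p, hp⟩ := h
  exact ⟨p.bypass, p.bypass_isPath, fun z hz => hp z (p.support_bypass_subset_support hz)⟩

theorem ConnIn.eq_or_exists_adj (h : G.ConnIn C x y) :
    x = y ∨ ∃ z, G.Adj x z ∧ G.ConnIn (C \ {x}) z y := by
  obtain ⟨p, hp, hC⟩ := h.exists_isPath
  cases p with
  | nil => exact Or.inl rfl
  | @cons _ z _ hxz p =>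
    rw [Walk.cons_isPath_iff] at hp
    refine Or.inr ⟨z, hxz, p, fun w hw => ⟨hC w (by simp [hw]), ?_⟩⟩
    rintro rfl
    exact hp.2 hw

end ConnIn

/-! ### Linkages and Menger's theorem -/

section Linkage

variable {V : Type*} {G : SimpleGraph V} {f g : V → V} {Q R : V → Set V}
  {S T T' A B Z : Finset V}

/-- The disjoint sets `Q x` link the vertices `x` of `S` to vertices `f x` of `T`. Apart from
their starting vertices they lie in `B` and avoid `A`. -/
structure IsLinkage (G : SimpleGraph V) (f : V → V) (Q : V → Set V) (S T A B : Finset V) :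
    Prop where
  connIn : ∀ x ∈ S, G.ConnIn (Q x) x (f x)
  mem : ∀ x ∈ S, f x ∈ T
  sub : ∀ x ∈ S, ∀ z ∈ Q x, z = x ∨ z ∈ B ∧ z ∉ A
  disj : ∀ x ∈ S, ∀ y ∈ S, x ≠ y → Disjoint (Q x) (Q y)

/-- The first linkage stays in Z, and the second avoids Z except at its starting vertices. So
distinct concatenated paths cannot meet. -/
theorem IsLinkage.trans (h : G.IsLinkage f Q S T A Z) (h' : G.IsLinkage g R T T' Z B)
    (hS : S ⊆ A) (hA : A ⊆ Z) (hZ : Z ⊆ B) :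
    G.IsLinkage (g ∘ f) (fun x => Q x ∪ R (f x)) S T' A B where
  connIn x hx := ((h.connIn x hx).mono Set.subset_union_left).trans
    ((h'.connIn _ (h.mem x hx)).mono Set.subset_union_right)
  mem x hx := h'.mem _ (h.mem x hx)
  sub x hx z hz := by
    have key : ∀ z ∈ Q x, z = x ∨ z ∈ B ∧ z ∉ A := fun z hz =>
      (h.sub x hx z hz).imp_right fun hz => ⟨hZ hz.1, hz.2⟩
    rcases hz with hz | hz
    · exact key z hz
    · rcases h'.sub _ (h.mem x hx) z hz with rfl | hz
      · exact key _ (h.connIn x hx).right_mem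
      · exact Or.inr ⟨hz.1, fun hzA => hz.2 (hA hzA)⟩
  disj x hx y hy hxy := by
    have key : ∀ x ∈ S, ∀ y ∈ S, x ≠ y → Disjoint (Q x) (R (f y)) := by
      intro x hx y hy hxy
      rw [Set.disjoint_left]
      intro z hz hz'
      rcases h'.sub _ (h.mem y hy) z hz' with rfl | hz'
      · exact Set.disjoint_left.1 (h.disj x hx y hy hxy) hz (h.connIn y hy).right_mem
      · rcases h.sub x hx z hz with rfl | hz
        exacts [hz'.2 (hA (hS hx)), hz'.2 hz.1]
    have hne : f x ≠ f y := fun e => Set.disjoint_left.1 (h.disj x hx y hy hxy)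
      (h.connIn x hx).right_mem (e ▸ (h.connIn y hy).right_mem)
    rw [Set.disjoint_union_left, Set.disjoint_union_right, Set.disjoint_union_right]
    exact ⟨⟨h.disj x hx y hy hxy, key x hx y hy hxy⟩, (key y hy x hx hxy.symm).symm,
      h'.disj _ (h.mem x hx) _ (h.mem y hy) hne⟩

/-- If `x` is a vertex of `S`, a linkage of the other vertices of `S` together with `v` extends
to a linkage of `S`, where either `v` is a new neighbour of `x` or `x` is linked to itself. -/
theorem IsLinkage.extend [DecidableEq V] {x : V} {P : Set V} {t : V} (hx : x ∈ S)
    (hS : S ⊆ A) (h : G.IsLinkage f Q (S.erase x) T A B) (hP : G.ConnIn P x t) (ht : t ∈ T)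
    (hPsub : ∀ z ∈ P, z = x ∨ z ∈ B ∧ z ∉ A)
    (hdisj : ∀ y ∈ S, y ≠ x → ∀ z ∈ P, z ≠ x → z ∉ Q y) :
    G.IsLinkage (Function.update f x t) (Function.update Q x P) S T A B := by
  have hd : ∀ y ∈ S, y ≠ x → Disjoint P (Q y) := by
    intro y hy hyx
    rw [Set.disjoint_left]
    intro z hz hz'
    by_cases hzx : z = x
    · subst hzx
      rcases h.sub y (Finset.mem_erase.2 ⟨hyx, hy⟩) z hz' with e | h'
      exacts [hyx e.symm, h'.2 (hS hx)]
    · exact hdisj y hy hyx z hz hzx hz'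
  refine ⟨fun y hy => ?_, fun y hy => ?_, fun y hy => ?_, fun y hy z hz hyz => ?_⟩
  · by_cases e : y = x
    · subst e; simpa using hP
    · simpa [e] using h.connIn y (Finset.mem_erase.2 ⟨e, hy⟩)
  · by_cases e : y = x
    · subst e; simpa using ht
    · simpa [e] using h.mem y (Finset.mem_erase.2 ⟨e, hy⟩)
  · by_cases e : y = x
    · subst e; simpa using hPsub
    · simpa [e] using h.sub y (Finset.mem_erase.2 ⟨e, hy⟩)
  · by_cases e : y = x
    · subst e
      simpa [Ne.symm hyz] using hd z hz (Ne.symm hyz)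
    · by_cases e' : z = x
      · subst e'
        simpa [e] using (hd y hy e).symm
      · simpa [e, e'] using h.disj y (Finset.mem_erase.2 ⟨e, hy⟩) z
          (Finset.mem_erase.2 ⟨e', hz⟩) hyz

/-- Menger's theorem for inner boundaries: if no set between `A` and `B` has fewer boundary
vertices than `A`, not counting those in `D`, then the boundary of `A` is linked to that
of `B`. -/
theorem exists_isLinkage [DecidableEq V] (G : SimpleGraph V) :
    ∀ (n : ℕ) {D A B : Finset V}, D ⊆ A → A ⊆ B →
    (B \ A).card + (G.innerBoundary A \ D).card ≤ n →
    (∀ Z, A ⊆ Z → Z ⊆ B → (G.innerBoundary A \ D).card ≤ (G.innerBoundary Z \ D).card) →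
    ∃ f Q, G.IsLinkage f Q (G.innerBoundary A \ D) (G.innerBoundary B \ D) A B := by
  intro n
  induction n with
  | zero =>
    intro D A B _ _ hn _
    have : G.innerBoundary A \ D = ∅ := by rw [← Finset.card_eq_zero]; omega
    rw [this]
    exact ⟨id, fun _ => ∅, by simp, by simp, by simp, by simp⟩
  | succ n ih =>
    intro D A B hDA hAB hn hmin
    have hSA : G.innerBoundary A \ D ⊆ A :=
      Finset.sdiff_subset.trans (G.innerBoundary_subset A)
    by_cases h1 : ∃ x ∈ G.innerBoundary A \ D, x ∈ G.innerBoundary B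
    · obtain ⟨x, hx, hxB⟩ := h1
      have hxA := hSA hx
      have hxD := (Finset.mem_sdiff.1 hx).2
      have heq : ∀ Z, G.innerBoundary Z \ insert x D = (G.innerBoundary Z \ D).erase x := by
        intro Z
        ext y
        simp only [Finset.mem_sdiff, Finset.mem_insert, Finset.mem_erase]
        tauto
      obtain ⟨-, y, hyB, hxy⟩ := mem_innerBoundary.1 hxB
      have hcard : ∀ Z, A ⊆ Z → Z ⊆ B →
          (G.innerBoundary Z \ insert x D).card + 1 = (G.innerBoundary Z \ D).card := by
        intro Z hAZ hZB
        rw [heq, Finset.card_erase_add_one]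
        exact Finset.mem_sdiff.2
          ⟨mem_innerBoundary.2 ⟨hAZ hxA, y, fun h => hyB (hZB h), hxy⟩, hxD⟩
      have hcA := hcard A subset_rfl hAB
      obtain ⟨f, Q, h⟩ := ih (Finset.insert_subset hxA hDA) hAB (by omega) fun Z h h' => by
        have := hcard Z h h'
        have := hmin Z h h'
        omega
      rw [heq, heq] at h
      refine ⟨_, _, IsLinkage.extend (P := {x}) hx hSA
        ⟨h.connIn, fun y hy => Finset.mem_of_mem_erase (h.mem y hy), h.sub, h.disj⟩
        (ConnIn.refl rfl) (Finset.mem_sdiff.2 ⟨hxB, hxD⟩) (fun z hz => Or.inl hz) ?_⟩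
      intro _ _ _ z hz hzx
      exact (hzx hz).elim
    by_cases h2 : ∃ Z, A ⊂ Z ∧ Z ⊂ B ∧
        (G.innerBoundary Z \ D).card = (G.innerBoundary A \ D).card
    · obtain ⟨Z, hAZ, hZB, hZ⟩ := h2
      have hc := Finset.card_sdiff_add_card_eq_card hAB
      have hcA := Finset.card_sdiff_add_card_eq_card hAZ.1
      have hcZ := Finset.card_sdiff_add_card_eq_card hZB.1
      have hltA := Finset.card_lt_card hAZ
      have hltZ := Finset.card_lt_card hZB
      obtain ⟨f, Q, h⟩ := ih hDA hAZ.1 (by omega) fun Z' h h' => hmin Z' h (h'.trans hZB.1)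
      obtain ⟨g, R, h'⟩ := ih (hDA.trans hAZ.1) hZB.1 (by omega)
        fun Z' h h' => hZ ▸ hmin Z' (hAZ.1.trans h) h'
      exact ⟨_, _, h.trans h' hSA hAZ.1 hZB.1⟩
    by_cases h3 : (G.innerBoundary A \ D).Nonempty
    swap
    · rw [Finset.not_nonempty_iff_eq_empty.1 h3]
      exact ⟨id, fun _ => ∅, by simp, by simp, by simp, by simp⟩
    obtain ⟨x, hx⟩ := h3
    have hxA := hSA hx
    have hxB : x ∉ G.innerBoundary B := fun h => h1 ⟨x, hx, h⟩
    obtain ⟨v, hvA, hxv⟩ := (mem_innerBoundary.1 (Finset.mem_sdiff.1 hx).1).2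
    have hvB : v ∈ B := by
      by_contra hvB
      exact hxB (mem_innerBoundary.2 ⟨hAB hxA, v, hvB, hxv⟩)
    have hA'B : insert v A ⊆ B := Finset.insert_subset hvB hAB
    -- With v added to A and x to D the bound persists: a proper subset Z of B has a spare boundary
    -- vertex, as no tight set lies strictly between, and x is not in the boundary of B. The path of
    -- x then starts with the edge to v.
    have hmin' : ∀ Z, insert v A ⊆ Z → Z ⊆ B →
        (G.innerBoundary A \ D).card ≤ (G.innerBoundary Z \ insert x D).card := by
      intro Z hAZ hZB
      have heq : (G.innerBoundary Z \ D).erase x ⊆ G.innerBoundary Z \ insert x D := by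
        intro y
        simp only [Finset.mem_sdiff, Finset.mem_insert, Finset.mem_erase]
        tauto
      refine le_trans ?_ (Finset.card_le_card heq)
      have hle := hmin Z ((Finset.subset_insert v A).trans hAZ) hZB
      rcases eq_or_ne Z B with rfl | hne
      · rwa [Finset.erase_eq_of_notMem fun h => hxB (Finset.mem_sdiff.1 h).1]
      · have hlt : (G.innerBoundary A \ D).card ≠ (G.innerBoundary Z \ D).card := fun h =>
          h2 ⟨Z, (Finset.ssubset_insert hvA).trans_subset hAZ, hZB.ssubset_of_ne hne, h.symm⟩
        have := Finset.pred_card_le_card_erase (s := G.innerBoundary Z \ D) (a := x)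
        omega
    have hsub : G.innerBoundary (insert v A) \ insert x D ⊆
        insert v ((G.innerBoundary A \ D).erase x) := by
      intro y hy
      have := @innerBoundary_insert_subset _ G A _ v y
      simp only [Finset.mem_sdiff, Finset.mem_insert, Finset.mem_erase] at hy this ⊢
      tauto
    have hcard : (insert v ((G.innerBoundary A \ D).erase x)).card
        = (G.innerBoundary A \ D).card := by
      rw [Finset.card_insert_of_notMem (fun h => hvA (hSA (Finset.mem_of_mem_erase h))),
        Finset.card_erase_add_one hx]
    have heq := Finset.eq_of_subset_of_card_le hsub (hcard ▸ hmin' _ subset_rfl hA'B)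
    have hlt : (B \ insert v A).card < (B \ A).card := by
      rw [Finset.sdiff_insert]
      exact Finset.card_erase_lt_of_mem (Finset.mem_sdiff.2 ⟨hvB, hvA⟩)
    obtain ⟨f, Q, h⟩ := ih (D := insert x D) (A := insert v A) (B := B)
      (Finset.insert_subset (Finset.mem_insert_of_mem hxA) (hDA.trans (Finset.subset_insert v A)))
      hA'B (by rw [heq, hcard]; omega)
      (by rw [heq, hcard]; exact hmin')
    rw [heq] at h
    have hvS := Finset.mem_insert_self v ((G.innerBoundary A \ D).erase x)
    have hTT : G.innerBoundary B \ insert x D ⊆ G.innerBoundary B \ D :=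
      Finset.sdiff_subset_sdiff subset_rfl (Finset.subset_insert x D)
    refine ⟨_, _, IsLinkage.extend (P := insert x (Q v)) (t := f v) (f := f) (Q := Q) hx hSA
      ⟨?_, ?_, ?_, ?_⟩ ?_ ?_ ?_ ?_⟩
    · exact fun y hy => h.connIn y (Finset.mem_insert_of_mem hy)
    · exact fun y hy => hTT (h.mem y (Finset.mem_insert_of_mem hy))
    · exact fun y hy z hz => (h.sub y (Finset.mem_insert_of_mem hy) z hz).imp_right
        fun hz => ⟨hz.1, fun hzA => hz.2 (Finset.mem_insert_of_mem hzA)⟩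
    · exact fun y hy z hz => h.disj y (Finset.mem_insert_of_mem hy) z
        (Finset.mem_insert_of_mem hz)
    · exact ((h.connIn v hvS).mono (Set.subset_insert x _)).cons hxv (Set.mem_insert x _)
    · exact hTT (h.mem v hvS)
    · rintro z (rfl | hz)
      · exact Or.inl rfl
      · refine Or.inr ?_
        rcases h.sub v hvS z hz with rfl | hz
        exacts [⟨hvB, hvA⟩, ⟨hz.1, fun hzA => hz.2 (Finset.mem_insert_of_mem hzA)⟩]
    · intro y hy hyx z hz hzx
      refine Set.disjoint_left.1 (h.disj v hvS y
        (Finset.mem_insert_of_mem (Finset.mem_erase.2 ⟨hyx, hy⟩)) ?_) (hz.resolve_left hzx)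
      rintro rfl
      exact hvA (hSA hy)

end Linkage

/-! ### Saturated sets -/

section Saturated

variable {V : Type*} [DecidableEq V] {G : SimpleGraph V} {w : ℕ} {X : Finset V}

/-- A buildable set that cannot be enlarged to a buildable set with at most as many boundary
vertices. -/
structure Saturated (G : SimpleGraph V) (w : ℕ) (X : Finset V) : Prop where
  buildable : G.Buildable w X
  eq_of_le : ∀ Y, X ⊆ Y → G.Buildable w Y →
    (G.innerBoundary Y).card ≤ (G.innerBoundary X).card → Y = X

theorem Buildable.exists_saturated [Fintype V] {m : ℕ} (hX : G.Buildable w X)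
    (hm : (G.innerBoundary X).card ≤ m) :
    ∃ Y, X ⊆ Y ∧ G.Saturated w Y ∧ (G.innerBoundary Y).card ≤ m := by
  classical
  obtain ⟨Y, hY, hmax⟩ := Finset.exists_max_image
    (Finset.univ.filter fun Y => X ⊆ Y ∧ G.Buildable w Y ∧ (G.innerBoundary Y).card ≤ m)
    Finset.card ⟨X, by simp [hX, hm]⟩
  simp only [Finset.mem_filter, Finset.mem_univ, true_and] at hY hmax
  refine ⟨Y, hY.1, ⟨hY.2.1, fun Z hYZ hZ hle => ?_⟩, hY.2.2⟩
  exact (Finset.eq_of_subset_of_card_le hYZ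
    (hmax Z ⟨hY.1.trans hYZ, hZ, hle.trans hY.2.2⟩)).symm

/-- A saturated set together with a new vertex can be enlarged to a saturated set with one more
boundary vertex, and the boundary of the former is linked to that of the latter. -/
theorem Saturated.exists_isLinkage [Fintype V] (hX : G.Saturated w X)
    (hw : (G.innerBoundary X).card ≤ w) {v : V} (hv : v ∉ X) :
    ∃ Y f Q, insert v X ⊆ Y ∧ G.Saturated w Y ∧
      (G.innerBoundary Y).card = (G.innerBoundary X).card + 1 ∧
      G.IsLinkage f Q (insert v (G.innerBoundary X)) (G.innerBoundary Y) (insert v X) Y := by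
  have hX' : G.Buildable w (insert v X) := hX.buildable.insert_vertex v hw
  have hlt : ∀ Z, insert v X ⊆ Z → G.Buildable w Z →
      (G.innerBoundary X).card + 1 ≤ (G.innerBoundary Z).card := by
    intro Z hZ hZ'
    by_contra! h
    rw [hX.eq_of_le Z ((Finset.subset_insert v X).trans hZ) hZ' (by omega)] at hZ
    exact hv (hZ (Finset.mem_insert_self v X))
  have hle := (Finset.card_le_card (innerBoundary_insert_subset (G := G) (X := X) v)).trans
    (Finset.card_insert_le _ _)
  have heq := Finset.eq_of_subset_of_card_le (innerBoundary_insert_subset (G := G) (X := X) v)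
    ((Finset.card_insert_le _ _).trans (hlt _ subset_rfl hX'))
  obtain ⟨Y, hXY, hY, hYle⟩ := hX'.exists_saturated hle
  have hmin : ∀ Z, insert v X ⊆ Z → Z ⊆ Y →
      (G.innerBoundary X).card + 1 ≤ (G.innerBoundary Z).card := by
    intro Z hXZ hZY
    -- A minimiser is buildable by `Buildable.of_subset`, so saturation of X bounds its boundary
    -- from below.
    obtain ⟨Z₀, hZ₀, hmin⟩ := Finset.exists_min_image (Finset.Icc (insert v X) Y)
      (fun Z => (G.innerBoundary Z).card) ⟨Z, Finset.mem_Icc.2 ⟨hXZ, hZY⟩⟩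
    rw [Finset.mem_Icc] at hZ₀
    refine (hlt Z₀ hZ₀.1 (hY.buildable.of_subset hZ₀.2 fun Z' h h' => ?_)).trans
      (hmin Z (Finset.mem_Icc.2 ⟨hXZ, hZY⟩))
    exact hmin Z' (Finset.mem_Icc.2 ⟨hZ₀.1.trans h, h'⟩)
  obtain ⟨f, Q, h⟩ := SimpleGraph.exists_isLinkage G _ (D := ∅) (Finset.empty_subset _) hXY le_rfl
    fun Z h h' => by simpa using hle.trans (hmin Z h h')
  rw [Finset.sdiff_empty, Finset.sdiff_empty, heq] at h
  exact ⟨Y, f, Q, hXY, hY, le_antisymm hYle (hlt Y hXY hY.buildable), h⟩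

end Saturated

/-! ### Growing a binary tree -/

section HangingTree

variable {V : Type*} {G : SimpleGraph V}

/-- The set `S` contains a subdivision of the complete binary tree of height `h`, together with a
path that leaves the root and ends at a neighbour of `x`. (The edges between a vertex and its
children are subdivided as well. A leaf is a single vertex.) -/
def HangingTree (G : SimpleGraph V) : ℕ → V → Set V → Prop
  | 0, x, S => ∃ v ∈ S, G.Adj x v
  | h + 1, x, S => ∃ (v r : V) (P : Set V) (C : Bool → Set V), G.Adj x v ∧ G.ConnIn P v r ∧
      P ⊆ S ∧ (∀ b, C b ⊆ S) ∧ (∀ b, Disjoint P (C b)) ∧ Disjoint (C false) (C true) ∧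
      ∀ b, HangingTree G h r (C b)

/-- The path P prolongs the path that leads into the tree. This moves the point of attachment back
from y to x. -/
theorem HangingTree.extend {h : ℕ} {x y : V} {P S T : Set V} (hP : G.ConnIn P x y)
    (hS : G.HangingTree h y S) (hd : Disjoint P S) (hPT : P \ {x} ⊆ T) (hST : S ⊆ T) :
    G.HangingTree h x T := by
  rcases hP.eq_or_exists_adj with rfl | ⟨z, hxz, hzy⟩ <;> cases h with
  | zero => ?_
  | succ h => ?_
  · obtain ⟨v, hv, hxv⟩ := hS
    exact ⟨v, hST hv, hxv⟩
  · obtain ⟨v, r, R, C, hxv, hR, hRS, hC, hrest⟩ := hS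
    exact ⟨v, r, R, C, hxv, hR, hRS.trans hST, fun b => (hC b).trans hST, hrest⟩
  -- For height zero the next vertex of the path already serves as the leaf.
  · exact ⟨z, hPT hzy.left_mem, hxz⟩
  · obtain ⟨v, r, R, C, hyv, hR, hRS, hC, hRC, hrest⟩ := hS
    refine ⟨z, r, P \ {x} ∪ R, C, hxz, ?_, Set.union_subset hPT (hRS.trans hST),
      fun b => (hC b).trans hST, fun b => ?_, hrest⟩
    · exact (hzy.mono Set.subset_union_left).trans
        (ConnIn.cons hyv (Or.inl hzy.right_mem) (hR.mono Set.subset_union_right))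
    · exact Set.disjoint_union_left.2
        ⟨(hd.mono_left Set.sdiff_subset).mono_right (hC b), hRC b⟩

end HangingTree

section Growth

variable {V : Type*} [Fintype V] [DecidableEq V] {G : SimpleGraph V} {w : ℕ}

/-- Each of the 2 ^ (h + 1) - 1 tree vertices adds one boundary vertex. The boundary is at most w
before every addition, hence the bound w + 1 at the end. The linkage, disjoint from the tree, lets
the induction go on from any old boundary vertex. -/
theorem Saturated.exists_hangingTree (h : ℕ) : ∀ {X : Finset V} {x : V}, G.Saturated w X →
    x ∈ G.innerBoundary X → (G.innerBoundary X).card + (2 ^ (h + 1) - 1) ≤ w + 1 →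
    ∃ (Y : Finset V) (f : V → V) (Q : V → Set V) (S : Set V), X ⊆ Y ∧ G.Saturated w Y ∧
      (G.innerBoundary Y).card = (G.innerBoundary X).card + (2 ^ (h + 1) - 1) ∧
      G.IsLinkage f Q (G.innerBoundary X) (G.innerBoundary Y) X Y ∧
      (∀ z ∈ S, z ∈ Y ∧ z ∉ X) ∧ (∀ z ∈ G.innerBoundary X, Disjoint (Q z) S) ∧
      G.HangingTree h x S := by
  -- one more vertex
  have step : ∀ {X : Finset V} {x : V}, G.Saturated w X → x ∈ G.innerBoundary X →
      (G.innerBoundary X).card ≤ w →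
      ∃ (Y : Finset V) (f : V → V) (Q : V → Set V) (v r : V) (P : Set V), X ⊆ Y ∧
        G.Saturated w Y ∧ (G.innerBoundary Y).card = (G.innerBoundary X).card + 1 ∧
        G.IsLinkage f Q (G.innerBoundary X) (G.innerBoundary Y) X Y ∧
        (∀ z ∈ P, z ∈ Y ∧ z ∉ X) ∧ (∀ z ∈ G.innerBoundary X, Disjoint (Q z) P) ∧
        G.Adj x v ∧ G.ConnIn P v r ∧ r ∈ G.innerBoundary Y ∧
        ∀ z ∈ G.innerBoundary X, f z ≠ r := by
    intro X x hX hx hw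
    obtain ⟨-, v, hv, hxv⟩ := mem_innerBoundary.1 hx
    obtain ⟨Y, f, Q, hXY, hY, hcard, hL⟩ := hX.exists_isLinkage hw hv
    have hvS := Finset.mem_insert_self v (G.innerBoundary X)
    have hne : ∀ z ∈ G.innerBoundary X, z ≠ v := by
      rintro z hz rfl
      exact hv (G.innerBoundary_subset X hz)
    have hd : ∀ z ∈ G.innerBoundary X, Disjoint (Q z) (Q v) := fun z hz =>
      hL.disj z (Finset.mem_insert_of_mem hz) v hvS (hne z hz)
    refine ⟨Y, f, Q, v, f v, Q v, (Finset.subset_insert v X).trans hXY, hY, hcard,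
      ⟨fun z hz => hL.connIn z (Finset.mem_insert_of_mem hz),
        fun z hz => hL.mem z (Finset.mem_insert_of_mem hz), ?_,
        fun y hy z hz => hL.disj y (Finset.mem_insert_of_mem hy) z (Finset.mem_insert_of_mem hz)⟩,
      ?_, hd, hxv, hL.connIn v hvS, hL.mem v hvS, ?_⟩
    · exact fun z hz y hy => (hL.sub z (Finset.mem_insert_of_mem hz) y hy).imp_right
        fun hy => ⟨hy.1, fun h => hy.2 (Finset.mem_insert_of_mem h)⟩
    · intro z hz
      rcases hL.sub v hvS z hz with rfl | hz
      exacts [⟨hXY (Finset.mem_insert_self _ _), hv⟩,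
        ⟨hz.1, fun h => hz.2 (Finset.mem_insert_of_mem h)⟩]
    · intro z hz e
      exact Set.disjoint_left.1 (hd z hz)
        (hL.connIn z (Finset.mem_insert_of_mem hz)).right_mem (e ▸ (hL.connIn v hvS).right_mem)
  induction h with
  | zero =>
    intro X x hX hx hw
    obtain ⟨Y, f, Q, v, r, P, hXY, hY, hcard, hL, hP, hQP, hxv, hvr, -⟩ :=
      step hX hx (by simpa using hw)
    exact ⟨Y, f, Q, P, hXY, hY, hcard, hL, hP, hQP, v, hvr.left_mem, hxv⟩
  | succ h ih =>
    intro X x hX hx hw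
    have hpow : 2 ^ (h + 1 + 1) = 2 ^ (h + 1) + 2 ^ (h + 1) := by ring
    have hpos : 1 ≤ 2 ^ (h + 1) := Nat.one_le_two_pow
    obtain ⟨Y₀, f₀, Q₀, v, r, P, hXY₀, hY₀, hcard₀, hL₀, hP, hQP, hxv, hvr, hr, hne⟩ :=
      step hX hx (by omega)
    obtain ⟨Y₁, f₁, Q₁, S₁, hY₀₁, hY₁, hcard₁, hL₁, hS₁, hQS₁, hT₁⟩ := ih hY₀ hr (by omega)
    -- While the first subtree grows at r, the linkage carries r to `f₁ r`. The second subtree grows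
    -- there and is attached to r along `Q₁ r`.
    obtain ⟨Y₂, f₂, Q₂, S₂, hY₁₂, hY₂, hcard₂, hL₂, hS₂, hQS₂, hT₂⟩ :=
      ih hY₁ (hL₁.mem r hr) (by omega)
    have hb₀ := G.innerBoundary_subset Y₀
    have hL₁₂ := hL₁.trans hL₂ hb₀ hY₀₁ hY₁₂
    have hL := hL₀.trans hL₁₂ (G.innerBoundary_subset X) hXY₀ (hY₀₁.trans hY₁₂)
    have hP₀ : ∀ z ∈ P, z ∈ Y₀ := fun z hz => (hP z hz).1
    have hQ₁ : ∀ z ∈ Q₁ r \ {r}, z ∈ Y₁ ∧ z ∉ Y₀ := fun z hz =>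
      (hL₁.sub r hr z hz.1).resolve_left hz.2
    have hS₂' : ∀ z ∈ S₂, z ∈ Y₂ ∧ z ∉ Y₀ := fun z hz =>
      ⟨(hS₂ z hz).1, fun h => (hS₂ z hz).2 (hY₀₁ h)⟩
    have hS₁' : ∀ z ∈ S₁, z ∈ Y₂ ∧ z ∉ Y₀ := fun z hz => ⟨hY₁₂ (hS₁ z hz).1, (hS₁ z hz).2⟩
    have hQ₁S₂ : ∀ z ∈ G.innerBoundary Y₀, Disjoint (Q₁ z) S₂ := by
      intro z hz
      rw [Set.disjoint_left]
      intro y hy hy'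
      rcases hL₁.sub z hz y hy with rfl | hy
      exacts [(hS₂' _ hy').2 (hb₀ hz), (hS₂ y hy').2 hy.1]
    -- the two children of the root
    let C : Bool → Set V := fun b => cond b (S₂ ∪ Q₁ r \ {r}) S₁
    have hC : ∀ b, ∀ z ∈ C b, z ∈ Y₂ ∧ z ∉ Y₀ := by
      rintro (_ | _) z hz
      · exact hS₁' z hz
      · rcases hz with hz | hz
        exacts [hS₂' z hz, ⟨hY₁₂ (hQ₁ z hz).1, (hQ₁ z hz).2⟩]
    have hQC : ∀ b, ∀ z ∈ G.innerBoundary Y₀, z ≠ r → Disjoint (Q₁ z ∪ Q₂ (f₁ z)) (C b) := by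
      intro b z hz hzr
      have hz₁ : Disjoint (Q₁ z ∪ Q₂ (f₁ z)) (Q₁ r) :=
        (hL₁₂.disj z hz r hr hzr).mono_right Set.subset_union_left
      cases b with
      | false =>
        refine Set.disjoint_union_left.2 ⟨hQS₁ z hz, Set.disjoint_left.2 fun y hy hy' => ?_⟩
        rcases hL₂.sub _ (hL₁.mem z hz) y hy with rfl | hy
        · exact Set.disjoint_left.1 (hQS₁ z hz) (hL₁.connIn z hz).right_mem hy'
        · exact hy.2 (hS₁ y hy').1
      | true =>
        exact Set.disjoint_union_right.2 ⟨Set.disjoint_union_left.2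
          ⟨hQ₁S₂ z hz, hQS₂ _ (hL₁.mem z hz)⟩, hz₁.mono_right Set.sdiff_subset⟩
    refine ⟨Y₂, _, _, P ∪ (C false ∪ C true), hXY₀.trans (hY₀₁.trans hY₁₂), hY₂, by omega, hL,
      ?_, ?_, v, r, P, C, hxv, hvr, Set.subset_union_left, ?_, ?_, ?_, ?_⟩
    · rintro z (hz | hz)
      · exact ⟨hY₁₂ (hY₀₁ (hP z hz).1), (hP z hz).2⟩
      · have : ∃ b, z ∈ C b := hz.elim (fun h => ⟨_, h⟩) fun h => ⟨_, h⟩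
        obtain ⟨b, hz⟩ := this
        exact ⟨(hC b z hz).1, fun h => (hC b z hz).2 (hXY₀ h)⟩
    · intro z hz
      have hfz := hL₀.mem z hz
      have key : ∀ b, Disjoint (Q₀ z ∪ (Q₁ (f₀ z) ∪ Q₂ (f₁ (f₀ z)))) (C b) := by
        intro b
        refine Set.disjoint_union_left.2 ⟨Set.disjoint_left.2 fun y hy hy' => ?_,
          hQC b _ hfz (hne z hz)⟩
        rcases hL₀.sub z hz y hy with rfl | hy
        exacts [(hC b _ hy').2 (hXY₀ (G.innerBoundary_subset X hz)), (hC b _ hy').2 hy.1]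
      refine Set.disjoint_union_right.2 ⟨Set.disjoint_union_left.2 ⟨hQP z hz, ?_⟩,
        Set.disjoint_union_right.2 ⟨key _, key _⟩⟩
      rw [Set.disjoint_left]
      intro y hy hy'
      rcases hL₁₂.sub _ hfz y hy with rfl | hy
      · exact Set.disjoint_left.1 (hQP z hz) (hL₀.connIn z hz).right_mem hy'
      · exact hy.2 (hP₀ y hy')
    · rintro (_ | _)
      exacts [fun z hz => Or.inr (Or.inl hz), fun z hz => Or.inr (Or.inr hz)]
    · exact fun b => Set.disjoint_left.2 fun z hz hz' => (hC b z hz').2 (hP₀ z hz)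
    · refine Set.disjoint_union_right.2 ⟨Set.disjoint_left.2 fun z hz hz' =>
        (hS₂ z hz').2 (hS₁ z hz).1, ?_⟩
      exact ((hQS₁ r hr).mono_left Set.sdiff_subset).symm
    · rintro (_ | _)
      · exact hT₁
      · exact HangingTree.extend (hL₁.connIn r hr) hT₂ (hQ₁S₂ r hr) Set.subset_union_right
          Set.subset_union_left

/-- A graph of large pathwidth contains a subdivided complete binary tree. -/
theorem exists_hangingTree_of_le_pathwidth (G : SimpleGraph V) (h : ℕ)
    (hG : 2 ^ (h + 1) ≤ G.pathwidth) : ∃ x S, G.HangingTree h x S := by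
  have hpos : 1 ≤ 2 ^ (h + 1) := Nat.one_le_two_pow
  obtain ⟨w, hw⟩ : ∃ w, G.pathwidth = w + 1 := ⟨G.pathwidth - 1, by omega⟩
  -- Start from a saturated set with empty boundary. Adding one vertex gives a boundary of size one,
  -- and the tree raises it to 2 ^ (h + 1) ≤ w + 1.
  obtain ⟨X, -, hX, hcard⟩ := (Buildable.empty (G := G) (w := w)).exists_saturated (m := 0)
    (by simp [innerBoundary_empty])
  have hne : X ≠ Finset.univ := by
    rintro rfl
    have := hX.buildable.pathwidth_le
    omega
  obtain ⟨v, hv⟩ : ∃ v, v ∉ X := by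
    by_contra! hX'
    exact hne (Finset.eq_univ_of_forall hX')
  obtain ⟨Y, f, Q, -, hY, hYcard, hL⟩ := hX.exists_isLinkage (by omega) hv
  obtain ⟨-, -, -, S, -, -, -, -, -, -, hS⟩ := hY.exists_hangingTree h
    (hL.mem v (Finset.mem_insert_self v _)) (by rw [hYcard]; omega)
  exact ⟨_, S, hS⟩

end Growth

/-! ### From trees of paths to subdivisions -/

section Subdivision

variable {V : Type*} {G : SimpleGraph V}

theorem Walk.exists_walk_coe {H : G.Subgraph} {x y : V} (p : G.Walk x y)
    (hv : ∀ z ∈ p.support, z ∈ H.verts) (he : ∀ e ∈ p.edges, e ∈ H.edgeSet) :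
    ∃ q : H.coe.Walk ⟨x, hv x p.start_mem_support⟩ ⟨y, hv y p.end_mem_support⟩,
      (∀ z, z ∈ q.support ↔ z.1 ∈ p.support) ∧
      (∀ z z', s(z, z') ∈ q.edges ↔ s(z.1, z'.1) ∈ p.edges) ∧ (p.IsPath → q.IsPath) := by
  induction p with
  | nil => exact ⟨Walk.nil, by simp [Subtype.ext_iff], by simp, by simp⟩
  | @cons x z y h p ih =>
    obtain ⟨q, hqs, hqe, hqp⟩ := ih (fun z hz => hv z (by simp [hz])) (fun e h => he e (by simp [h]))
    have hadj : H.Adj x z := he s(x, z) (by simp)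
    refine ⟨Walk.cons (show H.coe.Adj ⟨x, _⟩ ⟨z, _⟩ from hadj) q, ?_, ?_, ?_⟩
    · simp [hqs, Subtype.ext_iff]
    · simp [hqe, Subtype.ext_iff]
    · rw [Walk.cons_isPath_iff, Walk.cons_isPath_iff, hqs]
      exact fun h => ⟨hqp h.1, h.2⟩

/-- Let `R` orient the edges of the forest `F` from parents to children. If the vertices of `F`
are mapped into disjoint sets `Q`, and paths join them to their children, with all vertices but
the first in the set of the child, then these paths form a subdivision of `F`. -/
theorem exists_subgraph_isSubdivisionOf {W : Type*} {F : SimpleGraph W} {R : W → W → Prop}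
    (hF : ∀ a b, F.Adj a b ↔ R a b ∨ R b a) (hasymm : ∀ a b, R a b → ¬ R b a)
    (huniq : ∀ a b c, R a c → R b c → a = b) {branch : W → V} {Q : W → Set V}
    (hbranch : ∀ a, branch a ∈ Q a) (hdisj : ∀ a b, a ≠ b → Disjoint (Q a) (Q b))
    (hpath : ∀ a c, R a c → ∃ p : G.Walk (branch a) (branch c), p.IsPath ∧
      ∀ z ∈ p.support, z = branch a ∨ z ∈ Q c) :
    ∃ H : G.Subgraph, H.coe.IsSubdivisionOf F := by
  classical
  have hinj : ∀ a b x, x ∈ Q a → x ∈ Q b → a = b := fun a b x ha hb => by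
    by_contra hab
    exact Set.disjoint_left.1 (hdisj a b hab) ha hb
  choose p hp hpQ using hpath
  let H : G.Subgraph :=
    { verts := {x | (∃ a, branch a = x) ∨ ∃ a c h, x ∈ (p a c h).support}
      Adj := fun x y => ∃ a c h, s(x, y) ∈ (p a c h).edges
      adj_sub := fun ⟨a, c, h, hxy⟩ => (p a c h).adj_of_mem_edges hxy
      edge_vert := fun ⟨a, c, h, hxy⟩ => Or.inr ⟨a, c, h, Walk.fst_mem_support_of_mem_edges _ hxy⟩
      symm := ⟨fun x y ⟨a, c, h, hxy⟩ => ⟨a, c, h, by rwa [Sym2.eq_swap]⟩⟩ }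
  let β : W → H.verts := fun a => ⟨branch a, Or.inl ⟨a, rfl⟩⟩
  have hlift : ∀ a c (h : R a c), ∃ q : H.coe.Walk (β a) (β c),
      (∀ z, z ∈ q.support ↔ z.1 ∈ (p a c h).support) ∧
      (∀ z z', s(z, z') ∈ q.edges ↔ s(z.1, z'.1) ∈ (p a c h).edges) ∧
      ((p a c h).IsPath → q.IsPath) :=
    fun a c h => Walk.exists_walk_coe (H := H) (p a c h)
      (fun z hz => Or.inr ⟨a, c, h, hz⟩) (fun e he => by
        induction e with
        | h x y => exact ⟨a, c, h, he⟩)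
  choose q hqs hqe hqp using hlift
  let P : ∀ ⦃a b : W⦄, F.Adj a b → H.coe.Walk (β a) (β b) := fun a b h =>
    if hR : R a b then q a b hR else (q b a (((hF a b).1 h).resolve_left hR)).reverse
  have hP : ∀ a b (h : F.Adj a b), ∃ a' c' hR, s(a, b) = s(a', c') ∧
      ∀ x, x ∈ (P h).support ↔ x.1 ∈ (p a' c' hR).support := by
    intro a b h
    by_cases hR : R a b
    · exact ⟨a, b, hR, rfl, fun x => by simp only [P, hR, dif_pos, hqs]⟩
    · have hR' := ((hF a b).1 h).resolve_left hR
      refine ⟨b, a, hR', Sym2.eq_swap, fun x => ?_⟩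
      simp only [P, hR, dif_neg, not_false_eq_true, Walk.support_reverse, List.mem_reverse, hqs]
  refine ⟨H, ⟨⟨⟨β, fun a b h => ?_⟩, P, ?_, ?_, ?_, ?_, ?_, ?_⟩⟩⟩
  · exact hinj a b _ (hbranch a) (by rw [show branch a = branch b from congrArg Subtype.val h]
                                     exact hbranch b)
  · intro a b h
    have hpath : ∀ a c h, (q a c h).IsPath := fun a c h => hqp a c h (hp a c h)
    by_cases hR : R a b
    · simp only [P, hR, dif_pos, hpath]
    · simp only [P, hR, dif_neg, not_false_eq_true, Walk.isPath_reverse_iff, hpath]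
  · intro a b h
    by_cases hR : R a b
    · have hR' := hasymm a b hR
      simp only [P, hR, hR', dif_neg, dif_pos, not_false_eq_true]
    · have hR' := ((hF a b).1 h).resolve_left hR
      simp only [P, hR, hR', dif_neg, dif_pos, not_false_eq_true, Walk.reverse_reverse]
  · intro a b c h hc
    obtain ⟨a', c', hR, heq, hsupp⟩ := hP a b h
    have : c = a' ∨ c = c' := by
      rcases hpQ a' c' hR _ ((hsupp _).1 hc) with e | e
      · exact Or.inl (hinj c a' _ (hbranch c) (by rw [show branch c = branch a' from e]
                                                  exact hbranch a'))
      · exact Or.inr (hinj c c' _ (hbranch c) e)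
    have : c ∈ s(a, b) := by rw [heq]; simpa using this
    simpa using this
  · intro a b c d h h' hne x hx hx'
    obtain ⟨a₁, c₁, hR₁, heq₁, hsupp₁⟩ := hP a b h
    obtain ⟨a₂, c₂, hR₂, heq₂, hsupp₂⟩ := hP c d h'
    rcases hpQ _ _ hR₁ _ ((hsupp₁ x).1 hx) with e | hx₁
    · exact ⟨a₁, Subtype.ext e.symm⟩
    rcases hpQ _ _ hR₂ _ ((hsupp₂ x).1 hx') with e | hx₂
    · exact ⟨a₂, Subtype.ext e.symm⟩
    -- A common vertex that is not a branch vertex lies in the sets of both children. So the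
    -- children agree, and then so do their parents.
    obtain rfl := hinj _ _ _ hx₁ hx₂
    obtain rfl := huniq _ _ _ hR₁ hR₂
    exact (hne (heq₁.trans heq₂.symm)).elim
  · rintro ⟨x, ⟨a, rfl⟩ | ⟨a, c, hR, hx⟩⟩
    · exact Or.inl ⟨a, rfl⟩
    · refine Or.inr ⟨a, c, (hF a c).2 (Or.inl hR), ?_⟩
      simp only [P, hR, dif_pos, hqs]
      exact hx
  · rintro x y ⟨a, c, hR, hxy⟩
    refine ⟨a, c, (hF a c).2 (Or.inl hR), ?_⟩
    simp only [P, hR, dif_pos, hqe]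
    exact hxy

end Subdivision

section HangingTree

variable {V : Type*} {G : SimpleGraph V}

/-- In the words of this description of a hanging tree, the letters are read from the root. -/
theorem HangingTree.exists_words {h : ℕ} : ∀ {x : V} {S : Set V}, G.HangingTree h x S →
    ∃ (s r : List Bool → V) (Q : List Bool → Set V), G.Adj x (s []) ∧
      (∀ u, u.length ≤ h → G.ConnIn (Q u) (s u) (r u) ∧ Q u ⊆ S) ∧
      (∀ u b, u.length < h → G.Adj (r u) (s (u ++ [b]))) ∧
      ∀ u u', u.length ≤ h → u'.length ≤ h → u ≠ u' → Disjoint (Q u) (Q u') := by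
  induction h with
  | zero =>
    rintro x S ⟨v, hv, hxv⟩
    refine ⟨fun _ => v, fun _ => v, fun _ => {v}, hxv,
      fun u _ => ⟨ConnIn.refl rfl, by simpa using hv⟩, by simp, fun u u' hu hu' hne => ?_⟩
    rw [List.eq_nil_of_length_eq_zero (Nat.le_zero.1 hu),
      List.eq_nil_of_length_eq_zero (Nat.le_zero.1 hu')] at hne
    exact (hne rfl).elim
  | succ h ih =>
    rintro x S ⟨v, r₀, P, C, hxv, hP, hPS, hCS, hPC, hC, hT⟩
    choose s r Q h1 h2 h3 h4 using fun b => ih (hT b)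
    let s' : List Bool → V := fun u => match u with | [] => v | b :: u => s b u
    let r' : List Bool → V := fun u => match u with | [] => r₀ | b :: u => r b u
    let Q' : List Bool → Set V := fun u => match u with | [] => P | b :: u => Q b u
    refine ⟨s', r', Q', hxv, ?_, ?_, ?_⟩
    · rintro (_ | ⟨b, u⟩) hu
      · exact ⟨hP, hPS⟩
      · obtain ⟨h, h'⟩ := h2 b u (by simpa using hu)
        exact ⟨h, h'.trans (hCS b)⟩
    · rintro (_ | ⟨b, u⟩) c hu
      · exact h1 c
      · exact h3 b u c (by simpa using hu)
    · have key : ∀ b u, u.length ≤ h → Disjoint P (Q b u) := fun b u hu =>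
        (hPC b).mono_right (h2 b u hu).2
      have hCne : ∀ b b', b ≠ b' → Disjoint (C b) (C b') := by
        rintro (_ | _) (_ | _) hb
        exacts [(hb rfl).elim, hC, hC.symm, (hb rfl).elim]
      rintro (_ | ⟨b, u⟩) (_ | ⟨b', u'⟩) hu hu' hne
      · exact (hne rfl).elim
      · exact key b' u' (by simpa using hu')
      · exact (key b u (by simpa using hu)).symm
      · replace hu : u.length ≤ h := by simpa using hu
        replace hu' : u'.length ≤ h := by simpa using hu'
        by_cases hb : b = b'
        · subst hb
          exact h4 b u u' hu hu' fun e => hne (e ▸ rfl)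
        · exact ((hCne b b' hb).mono_left (h2 b u hu).2).mono_right (h2 b' u' hu').2

/-- The branch vertex of a word is the end `r` of its path, where the tree branches; the path from
the parent enters at `s` and stays in `Q`. Words are reversed because in `completeBinaryTree` the
last letter chosen comes first. -/
theorem HangingTree.exists_isSubdivisionOf {h : ℕ} {x : V} {S : Set V}
    (hT : G.HangingTree h x S) :
    ∃ H : G.Subgraph, H.coe.IsSubdivisionOf (completeBinaryTree h) := by
  obtain ⟨s, r, Q, -, h2, h3, h4⟩ := hT.exists_words
  refine exists_subgraph_isSubdivisionOf
    (R := fun a c : {l : List Bool // l.length ≤ h} => ∃ b, c.1 = b :: a.1)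
    (branch := fun l => r l.1.reverse) (Q := fun l => Q l.1.reverse)
    (fun a b => exists_or) ?_ ?_ ?_ ?_ ?_
  · rintro a b ⟨c, hc⟩ ⟨d, hd⟩
    have := congrArg List.length hc
    rw [hd] at this
    simp only [List.length_cons] at this
    omega
  · rintro a b c ⟨d, hd⟩ ⟨e, he⟩
    rw [hd, List.cons.injEq] at he
    exact Subtype.ext he.2
  · exact fun a => (h2 _ (by simpa using a.2)).1.right_mem
  · exact fun a b hab => h4 _ _ (by simpa using a.2) (by simpa using b.2)
      fun e => hab (Subtype.ext (List.reverse_injective e))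
  · rintro ⟨a, ha⟩ ⟨-, hc⟩ ⟨b, rfl⟩
    have hconn := (h2 (b :: a).reverse (by simpa using hc)).1
    have hadj : G.Adj (r a.reverse) (s (b :: a).reverse) := by
      rw [List.reverse_cons]
      exact h3 a.reverse b (by simpa using hc)
    exact (ConnIn.cons hadj (Set.mem_insert _ _)
      (hconn.mono (Set.subset_insert (r a.reverse) _))).exists_isPath

end HangingTree

/-! ### Bags met by connected sets -/

section Bags

variable {V : Type*} {G : SimpleGraph V}

/-- Follow the walk until an edge has its bag at or beyond m: the vertex before that edge occupies
bags on both sides of m. -/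
theorem PathDecomposition.exists_mem_bags (E : G.PathDecomposition) {C : Set V} {a b : V}
    (h : G.ConnIn C a b) {s m t : Fin (E.n + 1)} (hsm : s ≤ m) (hmt : m ≤ t)
    (ha : a ∈ E.bags s) (hb : b ∈ E.bags t) : ∃ z ∈ C, z ∈ E.bags m := by
  obtain ⟨p, hp⟩ := h
  induction p generalizing s with
  | nil => exact ⟨_, hp _ (by simp), E.mem_bags_of_le hsm hmt ha hb⟩
  | @cons a c b hac p ih =>
    obtain ⟨r, har, hcr⟩ := E.edge a c hac
    rcases le_total r m with hrm | hmr
    · exact ih hrm hcr hb fun z hz => hp z (by simp [hz])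
    · exact ⟨a, hp a (by simp), E.mem_bags_of_le hsm hmr ha har⟩

/-- Three legs join a vertex `c` to three sets, each contained in a bag and avoiding the legs of
the others. Then one of the sets and a vertex of a leg lie in a common bag. -/
theorem PathDecomposition.exists_card_lt (E : G.PathDecomposition) {c : V} {m : ℕ}
    {t : Fin 3 → Fin (E.n + 1)} {A : Fin 3 → Finset V} {L : Fin 3 → Set V}
    (hA : ∀ i, A i ⊆ E.bags (t i)) (hm : ∀ i, m ≤ (A i).card)
    (hconn : ∀ i, ∃ a ∈ A i, G.ConnIn (L i) c a) (hdisj : ∀ i j, i ≠ j → ∀ x ∈ A j, x ∉ L i) :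
    ∃ (i : Fin 3) (B : Finset V), A i ⊆ B ∧ B ⊆ E.bags (t i) ∧ m + 1 ≤ B.card ∧
      ∀ x ∈ B, x ∈ A i ∨ ∃ j, x ∈ L j := by
  classical
  have key : ∀ i j k, i ≠ j → k ≠ j → t i ≤ t j → t j ≤ t k →
      ∃ (i : Fin 3) (B : Finset V), A i ⊆ B ∧ B ⊆ E.bags (t i) ∧ m + 1 ≤ B.card ∧
        ∀ x ∈ B, x ∈ A i ∨ ∃ j, x ∈ L j := by
    intro i j k hij hkj htij htjk
    obtain ⟨a, ha, hca⟩ := hconn i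
    -- The bag of j is the middle one, so it meets the connection from i to k through c in a vertex
    -- outside `A j`.
    obtain ⟨b, hb, hcb⟩ := hconn k
    obtain ⟨z, hz, hzj⟩ := E.exists_mem_bags ((hca.symm.mono Set.subset_union_left).trans
      (hcb.mono Set.subset_union_right)) htij htjk (hA i ha) (hA k hb)
    have hzA : z ∉ A j := fun h => hz.elim (hdisj i j hij z h) (hdisj k j hkj z h)
    refine ⟨j, insert z (A j), Finset.subset_insert _ _, Finset.insert_subset hzj (hA j), ?_, ?_⟩
    · rw [Finset.card_insert_of_notMem hzA]
      exact Nat.succ_le_succ (hm j)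
    · intro x hx
      rcases Finset.mem_insert.1 hx with rfl | hx
      exacts [Or.inr (hz.elim (fun h => ⟨_, h⟩) fun h => ⟨_, h⟩), Or.inl hx]
  rcases le_total (t 0) (t 1) with h01 | h01 <;> rcases le_total (t 1) (t 2) with h12 | h12 <;>
    rcases le_total (t 0) (t 2) with h02 | h02
  · exact key 0 1 2 (by decide) (by decide) h01 h12
  · exact key 0 1 2 (by decide) (by decide) h01 h12
  · exact key 0 2 1 (by decide) (by decide) h02 h12
  · exact key 2 0 1 (by decide) (by decide) h02 h01
  · exact key 1 0 2 (by decide) (by decide) h01 h02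
  · exact key 1 2 0 (by decide) (by decide) h12 h02
  · exact key 2 1 0 (by decide) (by decide) h12 h01
  · exact key 2 1 0 (by decide) (by decide) h12 h01

end Bags

/-! ### Subdivided complete binary trees -/

namespace Subdivision

variable {V : Type*} {H : SimpleGraph V} {h : ℕ} (D : Subdivision (completeBinaryTree h) H)

/-- The vertex of a subdivided complete binary tree that represents the word `l`. -/
def node (l : List Bool) (hl : l.length ≤ h) : V := D.branch ⟨l, hl⟩

/-- The path from the vertex that represents the word `l` to its child `b :: l`. -/
def stem (l : List Bool) (b : Bool) (hl : (b :: l).length ≤ h) :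
    H.Walk (D.node l (Nat.le_of_succ_le hl)) (D.node (b :: l) hl) :=
  D.path (a := ⟨l, Nat.le_of_succ_le hl⟩) (b := ⟨b :: l, hl⟩) ⟨b, Or.inl rfl⟩

theorem node_inj {l m : List Bool} {hl : l.length ≤ h} {hm : m.length ≤ h}
    (e : D.node l hl = D.node m hm) : l = m :=
  congrArg Subtype.val (D.branch.injective e)

theorem eq_or_eq_of_node_mem_stem {l m : List Bool} {b : Bool} {hl : (b :: l).length ≤ h}
    {hm : m.length ≤ h} (hmem : D.node m hm ∈ (D.stem l b hl).support) : m = l ∨ m = b :: l :=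
  (D.branch_mem _ hmem).imp (congrArg Subtype.val) (congrArg Subtype.val)

theorem exists_node_of_mem_stem {l m : List Bool} {b c : Bool} {hl : (b :: l).length ≤ h}
    {hm : (c :: m).length ≤ h} {x : V} (hx : x ∈ (D.stem l b hl).support)
    (hx' : x ∈ (D.stem m c hm).support) :
    (l = m ∧ b = c) ∨ ∃ u hu, x = D.node u hu := by
  by_cases e : b :: l = c :: m
  · rw [List.cons.injEq] at e
    exact Or.inl e.symm
  · refine Or.inr ?_
    have hne : s((⟨l, Nat.le_of_succ_le hl⟩ : {l : List Bool // l.length ≤ h}), ⟨b :: l, hl⟩) ≠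
        s(⟨m, Nat.le_of_succ_le hm⟩, ⟨c :: m, hm⟩) := fun hs => by
      rcases Sym2.eq_iff.1 hs with ⟨-, h2⟩ | ⟨h1, h2⟩
      · exact e (congrArg Subtype.val h2)
      · have h1 := congrArg (fun w => w.1.length) h1
        have h2 := congrArg (fun w => w.1.length) h2
        simp only [List.length_cons] at h1 h2
        omega
    obtain ⟨⟨u, hu⟩, hux⟩ := D.disjoint _ _ hne x hx hx'
    exact ⟨u, hu, hux.symm⟩

theorem exists_stem {a b : {l : List Bool // l.length ≤ h}}
    (hab : (completeBinaryTree h).Adj a b) : ∃ l c hl,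
      (∀ x, x ∈ (D.path hab).support ↔ x ∈ (D.stem l c hl).support) ∧
      ∀ e, e ∈ (D.path hab).edges ↔ e ∈ (D.stem l c hl).edges := by
  obtain ⟨a, ha⟩ := a
  obtain ⟨b, hb⟩ := b
  obtain ⟨c, rfl | rfl⟩ := id hab
  · exact ⟨a, c, hb, fun _ => Iff.rfl, fun _ => Iff.rfl⟩
  · refine ⟨b, c, ha, fun x => ?_, fun e => ?_⟩
    · have := congrArg (fun p => x ∈ p.support) (D.path_symm hab)
      simp only [Walk.support_reverse, List.mem_reverse] at this
      exact this.symm.to_iff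
    · have := congrArg (fun p => e ∈ p.edges) (D.path_symm hab)
      simp only [Walk.edges_reverse, List.mem_reverse] at this
      exact this.symm.to_iff

section Bipartite

/-- The distance from the root in a subdivided complete binary tree. -/
def depth : List Bool → ℕ
  | [] => 0
  | b :: l => depth l + if hl : (b :: l).length ≤ h then (D.stem l b hl).length else 0

theorem stem_isPath (l : List Bool) (b : Bool) (hl : (b :: l).length ≤ h) :
    (D.stem l b hl).IsPath :=
  D.isPath _

theorem depth_add_eq {l m : List Bool} {b : Bool} {hl : (b :: l).length ≤ h}
    {hm : m.length ≤ h} {i : ℕ} (hi : i ≤ (D.stem l b hl).length)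
    (e : (D.stem l b hl).getVert i = D.node m hm) : D.depth l + i = D.depth m := by
  have hinj := (D.stem_isPath l b hl).getVert_injOn
  rcases D.eq_or_eq_of_node_mem_stem (e ▸ Walk.getVert_mem_support _ i) with rfl | rfl
  · have : i = 0 := hinj hi (Nat.zero_le _) (e.trans (Walk.getVert_zero _).symm)
    rw [this, Nat.add_zero]
  · have : i = (D.stem l b hl).length :=
      hinj hi (le_refl (D.stem l b hl).length) (e.trans (Walk.getVert_length _).symm)
    rw [depth, dif_pos hl, this]

/-- Colour by the parity of the depth. The depth is well defined, since two stems share only branch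
vertices, and it changes by one along each edge. -/
theorem isBipartite (D : Subdivision (completeBinaryTree h) H) : H.IsBipartite := by
  classical
  let Rel : V → ℕ → Prop := fun x n => ∃ l b hl, ∃ i ≤ (D.stem l b hl).length,
    (D.stem l b hl).getVert i = x ∧ n = D.depth l + i
  have hrel : ∀ x n m, Rel x n → Rel x m → n = m := by
    rintro x _ _ ⟨l, b, hl, i, hi, hix, rfl⟩ ⟨m, c, hm, j, hj, hjx, rfl⟩
    rcases D.exists_node_of_mem_stem (hix ▸ Walk.getVert_mem_support _ i)
      (hjx ▸ Walk.getVert_mem_support _ j) with ⟨rfl, rfl⟩ | ⟨u, hu, rfl⟩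
    · rw [(D.stem_isPath l b hl).getVert_injOn hi hj (hix.trans hjx.symm)]
    · rw [D.depth_add_eq hi hix, D.depth_add_eq hj hjx]
  -- The default value is harmless, since a vertex on no stem has no neighbour.
  let f : V → ℕ := fun x => if hx : ∃ n, Rel x n then hx.choose else 0
  have hf : ∀ x n, Rel x n → f x = n := by
    intro x n hx
    have hx' : ∃ n, Rel x n := ⟨n, hx⟩
    simp only [f, dif_pos hx']
    exact hrel x _ _ hx'.choose_spec hx
  let C : H.Coloring Bool := Coloring.mk (fun x => decide (Even (f x))) (by
    intro x y hxy
    obtain ⟨a, b, hab, he⟩ := D.edge x y hxy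
    obtain ⟨l, c, hl, -, hedges⟩ := D.exists_stem hab
    rw [hedges, Walk.mk_mem_edges_iff_exists] at he
    have key : ∀ i < (D.stem l c hl).length, ¬ (Even (f ((D.stem l c hl).getVert i)) ↔
        Even (f ((D.stem l c hl).getVert (i + 1)))) := by
      intro i hi
      rw [hf _ _ ⟨l, c, hl, i, hi.le, rfl, rfl⟩, hf _ _ ⟨l, c, hl, i + 1, hi, rfl, rfl⟩,
        ← add_assoc, Nat.even_add_one (n := D.depth l + i)]
      tauto
    obtain ⟨i, hi, he⟩ := he
    rcases Sym2.eq_iff.1 he with ⟨rfl, rfl⟩ | ⟨rfl, rfl⟩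
    · exact fun e => key i hi (decide_eq_decide.1 e)
    · exact fun e => key i hi (decide_eq_decide.1 e.symm))
  exact C.colorable

end Bipartite

/-! ### Lower bound for the pathwidth -/

section Pathwidth

/-- The vertices of a subdivided complete binary tree that lie in the subtree below `l`. -/
def below (l : List Bool) : Set V :=
  {x | (∃ m hm, l <:+ m ∧ x = D.node m hm) ∨
    ∃ m b hm, l <:+ m ∧ x ∈ (D.stem m b hm).support}

theorem node_mem_below {l m : List Bool} (hm : m.length ≤ h) (hlm : l <:+ m) :
    D.node m hm ∈ D.below l :=
  Or.inl ⟨m, hm, hlm, rfl⟩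

theorem mem_below_of_mem_stem {l m : List Bool} {b : Bool} {hm : (b :: m).length ≤ h}
    (hlm : l <:+ m) {x : V} (hx : x ∈ (D.stem m b hm).support) : x ∈ D.below l :=
  Or.inr ⟨m, b, hm, hlm, hx⟩

theorem below_subset {l m : List Bool} (hlm : l <:+ m) : D.below m ⊆ D.below l := by
  rintro x (⟨u, hu, hmu, rfl⟩ | ⟨u, b, hu, hmu, hx⟩)
  exacts [Or.inl ⟨u, hu, hlm.trans hmu, rfl⟩, Or.inr ⟨u, b, hu, hlm.trans hmu, hx⟩]

theorem suffix_of_node_mem_below {l m : List Bool} {hm : m.length ≤ h}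
    (hx : D.node m hm ∈ D.below l) : l <:+ m := by
  rcases hx with ⟨u, hu, hlu, e⟩ | ⟨u, b, hu, hlu, hx⟩
  · rwa [D.node_inj e]
  · rcases D.eq_or_eq_of_node_mem_stem hx with rfl | rfl
    exacts [hlu, hlu.trans (List.suffix_cons b u)]

/-- When `l` is at least as long as `b :: m`, this forces equality: the only stem from above that
meets the subtree below `l` is the one ending at `l`. -/
theorem suffix_of_mem_stem {l m : List Bool} {b : Bool} {hm : (b :: m).length ≤ h} {x : V}
    (hx : x ∈ (D.stem m b hm).support) (hx' : x ∈ D.below l) : l <:+ b :: m := by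
  have key : ∀ u hu, D.node u hu ∈ (D.stem m b hm).support → D.node u hu ∈ D.below l →
      l <:+ b :: m := by
    intro u hu h1 h2
    have := D.suffix_of_node_mem_below h2
    rcases D.eq_or_eq_of_node_mem_stem h1 with rfl | rfl
    exacts [this.trans (List.suffix_cons b u), this]
  rcases id hx' with ⟨u, hu, hlu, rfl⟩ | ⟨u, c, hu, hlu, hxu⟩
  · exact key u hu hx hx'
  · rcases D.exists_node_of_mem_stem hx hxu with ⟨rfl, rfl⟩ | ⟨v, hv, rfl⟩
    exacts [hlu.trans (List.suffix_cons b m), key v hv hx hx']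

theorem suffix_or_suffix_of_mem_below {l m : List Bool} {x : V} (hx : x ∈ D.below l)
    (hx' : x ∈ D.below m) : ∃ u, l <:+ u ∧ m <:+ u := by
  rcases hx with ⟨u, hu, hlu, rfl⟩ | ⟨u, b, hu, hlu, hx⟩
  · exact ⟨u, hlu, D.suffix_of_node_mem_below hx'⟩
  · exact ⟨b :: u, hlu.trans (List.suffix_cons b u), D.suffix_of_mem_stem hx hx'⟩

/-- The large set is confined to the subtree and joined to its root inside it, so that it can serve
as the end of a leg one stage higher up. -/
theorem exists_card_le_bag (E : H.PathDecomposition) (j : ℕ) :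
    ∀ (l : List Bool) (hl : l.length + (2 * j + 1) ≤ h), ∃ (t : Fin (E.n + 1)) (A : Finset V),
      A ⊆ E.bags t ∧ j + 2 ≤ A.card ∧ (∀ x ∈ A, x ∈ D.below l) ∧
      ∃ a ∈ A, H.ConnIn (D.below l) (D.node l (by omega)) a := by
  classical
  induction j with
  | zero =>
    intro l hl
    have hl' : (false :: l).length ≤ h := by simpa using hl
    have hnil : ¬ (D.stem l false hl').Nil := fun hn => by
      have := D.node_inj hn.eq
      simp at this
    have hadj := Walk.adj_snd hnil
    obtain ⟨t, ht, ht'⟩ := E.edge _ _ hadj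
    have hmem := D.node_mem_below (l := l) (m := l) (by omega) List.suffix_rfl
    refine ⟨t, {D.node l (by omega), (D.stem l false hl').snd}, ?_, ?_, ?_, ?_⟩
    · simp [Finset.insert_subset_iff, ht, ht']
    · rw [Finset.card_pair hadj.ne]
    · intro x hx
      rcases Finset.mem_insert.1 hx with rfl | hx
      · exact hmem
      · rw [Finset.mem_singleton.1 hx]
        exact D.mem_below_of_mem_stem (hm := hl') List.suffix_rfl (Walk.getVert_mem_support _ _)
    · exact ⟨_, Finset.mem_insert_self _ _, ConnIn.refl hmem⟩
  | succ j ih =>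
    intro l hl
    have hl0 : (false :: l).length ≤ h := by rw [List.length_cons]; omega
    have hl1 : (true :: l).length ≤ h := by rw [List.length_cons]; omega
    -- Three of the four grandchildren suffice. The legs start at the child `false :: l`; the third
    -- passes through `l` and `true :: l`.
    let ws : Fin 3 → List Bool := ![false :: false :: l, true :: false :: l, false :: true :: l]
    have hlen : ∀ i, (ws i).length = l.length + 2 := by
      intro i
      fin_cases i <;> rfl
    have hws : ∀ i, (ws i).length ≤ h := fun i => by rw [hlen]; omega
    have hinj : ∀ i i', i ≠ i' → ws i ≠ ws i' := by
      intro i i' hne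
      fin_cases i <;> fin_cases i' <;> simp [ws] at hne ⊢
    have hsuff : ∀ i, l <:+ ws i := by
      intro i
      fin_cases i <;> exact ⟨[_, _], rfl⟩
    choose t A hA hcard hbelow a ha hconn using fun i => ih (ws i) (by rw [hlen]; omega)
    let L : Fin 3 → Set V := ![
      D.below (ws 0) ∪ {x | x ∈ (D.stem (false :: l) false (hws 0)).support},
      D.below (ws 1) ∪ {x | x ∈ (D.stem (false :: l) true (hws 1)).support},
      D.below (ws 2) ∪ {x | x ∈ (D.stem (true :: l) false (hws 2)).support ∨
        x ∈ (D.stem l false hl0).support ∨ x ∈ (D.stem l true hl1).support}]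
    -- the subtrees avoid each other and the paths to the other subtrees
    have hbb : ∀ i i', i ≠ i' → ∀ x ∈ D.below (ws i'), x ∉ D.below (ws i) := by
      intro i i' hne x hx hx'
      obtain ⟨u, hu, hu'⟩ := D.suffix_or_suffix_of_mem_below hx hx'
      exact hinj i' i hne.symm ((List.suffix_of_suffix_length_le hu hu'
        (by rw [hlen, hlen])).eq_of_length (by rw [hlen, hlen]))
    have hbs : ∀ i m b hm, (b :: m).length ≤ l.length + 2 → ∀ x ∈ D.below (ws i),
        x ∈ (D.stem m b hm).support → ws i = b :: m := by
      intro i m b hm hle x hx hx'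
      exact (D.suffix_of_mem_stem hx' hx).eq_of_length_le (by rwa [hlen])
    have hL : ∀ i, L i ⊆ D.below l := by
      have h0 : l <:+ false :: l := List.suffix_cons _ _
      have h1 : l <:+ true :: l := List.suffix_cons _ _
      intro i
      fin_cases i
      · exact Set.union_subset (D.below_subset (hsuff 0)) fun x hx => D.mem_below_of_mem_stem h0 hx
      · exact Set.union_subset (D.below_subset (hsuff 1)) fun x hx => D.mem_below_of_mem_stem h0 hx
      · refine Set.union_subset (D.below_subset (hsuff 2)) ?_
        rintro x (hx | hx | hx)
        exacts [D.mem_below_of_mem_stem h1 hx, D.mem_below_of_mem_stem List.suffix_rfl hx,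
          D.mem_below_of_mem_stem List.suffix_rfl hx]
    have hdisj : ∀ i i', i ≠ i' → ∀ x ∈ A i', x ∉ L i := by
      intro i i' hne x hx
      replace hx := hbelow i' x hx
      have hbx := hbb i i' hne x hx
      have hbs' : ∀ m b hm, (b :: m).length ≤ l.length + 2 → ws i' ≠ b :: m →
          x ∉ (D.stem m b hm).support := fun m b hm hle hne h => hne (hbs i' m b hm hle x hx h)
      have hshort : ∀ b, ws i' ≠ b :: l := fun b e => by
        have := congrArg List.length e
        rw [hlen, List.length_cons] at this
        omega
      have hne' := hinj i' i hne.symm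
      fin_cases i
      · exact fun h => h.elim hbx (hbs' _ _ _ le_rfl hne')
      · exact fun h => h.elim hbx (hbs' _ _ _ le_rfl hne')
      · rintro (h | h | h | h)
        · exact hbx h
        · exact hbs' _ _ _ le_rfl hne' h
        · exact hbs' _ _ _ (by simp) (hshort _) h
        · exact hbs' _ _ _ (by simp) (hshort _) h
    have hleg : ∀ i, H.ConnIn (L i) (D.node (false :: l) hl0) (a i) := by
      intro i
      fin_cases i
      · exact ConnIn.trans ⟨D.stem (false :: l) false (hws 0), fun z hz => Or.inr hz⟩
          ((hconn 0).mono Set.subset_union_left)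
      · exact ConnIn.trans ⟨D.stem (false :: l) true (hws 1), fun z hz => Or.inr hz⟩
          ((hconn 1).mono Set.subset_union_left)
      · have h1 : H.ConnIn (L 2) (D.node l (by omega)) (D.node (false :: l) hl0) :=
          ⟨D.stem l false hl0, fun z hz => Or.inr (Or.inr (Or.inl hz))⟩
        have h2 : H.ConnIn (L 2) (D.node l (by omega)) (D.node (true :: l) hl1) :=
          ⟨D.stem l true hl1, fun z hz => Or.inr (Or.inr (Or.inr hz))⟩
        have h3 : H.ConnIn (L 2) (D.node (true :: l) hl1) (D.node (ws 2) (hws 2)) :=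
          ⟨D.stem (true :: l) false (hws 2), fun z hz => Or.inr (Or.inl hz)⟩
        exact h1.symm.trans (h2.trans (h3.trans ((hconn 2).mono Set.subset_union_left)))
    obtain ⟨i, B, hAB, hBE, hB, hBL⟩ := E.exists_card_lt hA hcard
      (fun i => ⟨a i, ha i, hleg i⟩) hdisj
    have hroot : H.ConnIn (D.below l) (D.node l (by omega)) (D.node (false :: l) hl0) :=
      ⟨D.stem l false hl0, fun z hz => D.mem_below_of_mem_stem List.suffix_rfl hz⟩
    refine ⟨t i, B, hBE, hB, fun x hx => ?_, a i, hAB (ha i), hroot.trans ((hleg i).mono (hL i))⟩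
    rcases hBL x hx with hx | ⟨i', hx⟩
    exacts [D.below_subset (hsuff i) (hbelow i x hx), hL i' hx]

theorem le_pathwidth [Finite V] (D : Subdivision (completeBinaryTree h) H) {j : ℕ}
    (hj : 2 * j + 1 ≤ h) : j + 1 ≤ H.pathwidth := by
  obtain ⟨E, hE⟩ := H.exists_width_eq_pathwidth
  obtain ⟨t, A, hA, hcard, -⟩ := D.exists_card_le_bag E j [] (by simpa using hj)
  have h1 : (E.bags t).card - 1 ≤ E.width :=
    Finset.le_sup (f := fun t => (E.bags t).card - 1) (Finset.mem_univ t)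
  have h2 := Finset.card_le_card hA
  omega

end Pathwidth

end Subdivision

end SimpleGraph

theorem mainTheorem4 {V : Type*} [Finite V] (G : SimpleGraph V) (k : ℕ) (hk : 1 ≤ k)
    (hG : 2 ^ (2 * k + 1) - 2 ≤ G.pathwidth) :
    ∃ H : G.Subgraph,
      H.coe.IsBipartite ∧
      (∃ h : ℕ, H.coe.IsSubdivisionOf (SimpleGraph.completeBinaryTree h)) ∧
      k ≤ H.coe.pathwidth := by
  classical
  have := Fintype.ofFinite V
  obtain ⟨j, rfl⟩ : ∃ j, k = j + 1 := ⟨k - 1, by omega⟩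
  -- Height 2j + 1 = 2k - 1 needs only pathwidth 2^(2k), and 2^(2k) ≤ 2 · 2^(2k) - 2.
  have hle : 2 ^ (2 * j + 1 + 1) ≤ G.pathwidth := by
    refine le_trans ?_ hG
    have hpow : 2 ^ (2 * (j + 1) + 1) = 2 * 2 ^ (2 * j + 1 + 1) := by ring
    have hpos := Nat.one_lt_two_pow (n := 2 * j + 1 + 1) (by omega)
    omega
  obtain ⟨x, S, hS⟩ := G.exists_hangingTree_of_le_pathwidth (2 * j + 1) hle
  obtain ⟨H, ⟨D⟩⟩ := hS.exists_isSubdivisionOf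
  exact ⟨H, D.isBipartite, ⟨_, ⟨D⟩⟩, D.le_pathwidth le_rfl⟩
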